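/- Let $H$ be a Hilbert space over $\mathbb{K}\in\{\mathbb{R},\mathbb{C}\}$ and let $B:\mathcal{D}(B)\subset H\to H$ be a densely defined closed linear operator such that, for some $\gamma>0$, $\|Bu\|_H^2\ge\gamma\|u\|_H^2$ for all $u\in\mathcal{D}(B)$. Let $A:=B^*B$ with its natural domain $\mathcal{D}(A)=\{u\in\mathcal{D}(B): Bu\in\mathcal{D}(B^*)\}$. Let $Y:=\mathcal{D}(B)$ with norm $\|u\|_Y:=\|Bu\|_H$, let $X:=Y\times H$ with norm $\|(u,v)\|_X^2:=\|Bu\|_H^2+\|v\|_H^2$, and define $L:\mathcal{D}(L)\subset X\to X$ by $\mathcal{D}(L):=\mathcal{D}(A)\times\mathcal{D}(B)$ and $L(u,v):=(v,-Au)$, i.e. $L=\begin{pmatrix}0&1\\-A&0\end{pmatrix}$. Then $X$ is a Banach space, and $L$ is the generator of a strongly continuous one-parameter semigroup $S:[0,\infty)\to\mathcal{B}(X)$ with $\|S(t)\|_{\mathcal{B}(X)}\le 1$ for all $t>0$. (That is, $S(0)=\mathrm{id}_X$, $S(t+s)=S(t)S(s)$ for $t,s\ge0$, $t\mapsto S(t)x$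 is continuous on $[0,\infty)$ for each $x\in X$, $\mathcal{D}(L)$ is the set of all $x\in X$ for which $\lim_{t\to0+}\frac1t(S(t)x-x)$ exists in $X$, and $Lx$ is this limit.) In particular, the abstract evolution problem $$\tfrac{d}{dt}\mathbf{u}(t)=L\mathbf{u}(t)\ \text{ for } t>0,\qquad \mathbf{u}(0)=\mathbf{u}_0,$$ is well-posed in the following sense. For every $\mathbf{u}_0\in\mathcal{D}(L)$ there is a unique classical solution, i.e. a unique function $\mathbf{u}:[0,\infty)\to\mathcal{D}(L)\subset X$ that is continuously differentiable on $[0,\infty)$ as an $X$-valued function (with one-sided derivative at $0$) and satisfies both equations. Moreover, solutions depend continuously on the data, uniformly on compact time intervals: for all $T>0$ and $\varepsilon>0$ there is $\delta>0$ such that any two classical solutions $\mathbf{u},\mathbf{v}$ with initial data $\mathbf{u}_0,\mathbf{v}_0\in\mathcal{D}(L)$, $\|\mathbf{u}_0-\mathbf{v}_0\|_X<\delta$, satisfy $\|\mathbf{u}(t)-\mathbf{v}(t)\|_X<\varepsilon$ for all $t\in[0,T]$. -/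

import Mathlib

open Filter Topology
open scoped NNReal

namespace AbstractWave

noncomputable section

section Operators

variable {𝕜 H : Type*} [RCLike 𝕜] [NormedAddCommGroup H] [InnerProductSpace 𝕜 H]

/-- The product `T R` of two partially defined linear operators, with its natural domain
`{x ∈ Dom(R) : R x ∈ Dom(T)}`. -/
def opProd (T R : H →ₗ.[𝕜] H) : H →ₗ.[𝕜] H where
  domain :=
    { carrier := {x | ∃ hx : x ∈ R.domain, R ⟨x, hx⟩ ∈ T.domain}
      zero_mem' := ⟨R.domain.zero_mem, by
        have h : R ⟨0, R.domain.zero_mem⟩ = 0 := R.map_zero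
        rw [h]; exact T.domain.zero_mem⟩
      add_mem' := by
        rintro x y ⟨hx, hx'⟩ ⟨hy, hy'⟩
        refine ⟨R.domain.add_mem hx hy, ?_⟩
        have h : R ⟨x + y, R.domain.add_mem hx hy⟩ = R ⟨x, hx⟩ + R ⟨y, hy⟩ :=
          R.map_add ⟨x, hx⟩ ⟨y, hy⟩
        rw [h]; exact T.domain.add_mem hx' hy'
      smul_mem' := by
        rintro c x ⟨hx, hx'⟩
        refine ⟨R.domain.smul_mem c hx, ?_⟩
        have h : R ⟨c • x, R.domain.smul_mem c hx⟩ = c • R ⟨x, hx⟩ := R.map_smul c ⟨x, hx⟩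
        rw [h]; exact T.domain.smul_mem c hx' }
  toFun :=
    { toFun := fun x => T ⟨R ⟨x.1, x.2.fst⟩, x.2.snd⟩
      map_add' := by
        rintro ⟨x, hx, hx'⟩ ⟨y, hy, hy'⟩
        rw [← T.map_add]
        congr 1
        exact Subtype.ext (R.map_add ⟨x, hx⟩ ⟨y, hy⟩)
      map_smul' := by
        rintro c ⟨x, hx, hx'⟩
        rw [RingHom.id_apply, ← T.map_smul]
        congr 1
        exact Subtype.ext (R.map_smul c ⟨x, hx⟩) }

/-- `‖B u‖² ≥ γ ‖u‖²` on `Dom(B)`, for some `γ > 0`. -/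
def BoundedBelow (B : H →ₗ.[𝕜] H) : Prop :=
  ∃ γ : ℝ, 0 < γ ∧ ∀ u : B.domain, γ * ‖(u : H)‖ ^ 2 ≤ ‖B u‖ ^ 2

theorem BoundedBelow.injective {B : H →ₗ.[𝕜] H} (hB : BoundedBelow B) :
    Function.Injective B.toFun := by
  obtain ⟨γ, hγ, h⟩ := hB
  rw [injective_iff_map_eq_zero]
  intro u hu
  have h1 := h u
  have h2 : B u = 0 := hu
  rw [h2, norm_zero] at h1
  have h3 : ‖(u : H)‖ = 0 := by
    by_contra h4
    have : 0 < ‖(u : H)‖ ^ 2 := by positivity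
    nlinarith
  exact Subtype.ext (norm_eq_zero.mp h3)

/-- The space `Y = Dom(B)`, to be normed by `‖u‖_Y = ‖B u‖` (not by the norm of `H`). -/
def Y (B : H →ₗ.[𝕜] H) (_hB : BoundedBelow B) : Type _ := B.domain

variable (B : H →ₗ.[𝕜] H) (hB : BoundedBelow B)

instance : AddCommGroup (Y B hB) := inferInstanceAs (AddCommGroup B.domain)

instance : Module 𝕜 (Y B hB) := inferInstanceAs (Module 𝕜 B.domain)

/-- `Y` is `Dom(B)` as a vector space. -/
def Y.equiv : Y B hB ≃ₗ[𝕜] B.domain := LinearEquiv.refl 𝕜 B.domain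

/-- The operator `B` as an everywhere defined linear map `Y → H`. -/
def Y.map : Y B hB →ₗ[𝕜] H := B.toFun ∘ₗ (Y.equiv B hB).toLinearMap

instance : NormedAddCommGroup (Y B hB) :=
  NormedAddCommGroup.induced (Y B hB) H (Y.map B hB)
    (hB.injective.comp (Y.equiv B hB).injective)

instance : NormedSpace 𝕜 (Y B hB) := NormedSpace.induced 𝕜 (Y B hB) H (Y.map B hB)

theorem Y.norm_eq (u : Y B hB) : ‖u‖ = ‖B (Y.equiv B hB u)‖ := rfl

/-- The energy space `X = Y × H` with `‖(u, v)‖² = ‖B u‖² + ‖v‖²`. -/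
abbrev X : Type _ := WithLp 2 (Y B hB × H)

theorem X.norm_sq (x : X B hB) :
    ‖x‖ ^ 2 = ‖B (Y.equiv B hB x.fst)‖ ^ 2 + ‖x.snd‖ ^ 2 := by
  rw [WithLp.prod_norm_sq_eq_of_L2, Y.norm_eq]

variable [CompleteSpace H]

/-- The operator `A = B* B` in `H`. -/
def opA : H →ₗ.[𝕜] H := opProd B.adjoint B

/-- `Dom(L) = Dom(A) × Dom(B)`. -/
def domL : Submodule 𝕜 (X B hB) where
  carrier := {x | (Y.equiv B hB x.fst : H) ∈ (opA B).domain ∧ x.snd ∈ B.domain}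
  zero_mem' := ⟨(opA B).domain.zero_mem, B.domain.zero_mem⟩
  add_mem' hx hy := ⟨(opA B).domain.add_mem hx.1 hy.1, B.domain.add_mem hx.2 hy.2⟩
  smul_mem' c _ hx := ⟨(opA B).domain.smul_mem c hx.1, B.domain.smul_mem c hx.2⟩

/-- `(u, v) ↦ v` from `Dom(L)` to `Y`. -/
def opL₁ : domL B hB →ₗ[𝕜] Y B hB where
  toFun x := (Y.equiv B hB).symm ⟨x.1.snd, x.2.2⟩
  map_add' _ _ := rfl
  map_smul' _ _ := rfl

/-- `(u, v) ↦ -A u` from `Dom(L)` to `H`. -/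
def opL₂ : domL B hB →ₗ[𝕜] H where
  toFun x := -(opA B) ⟨Y.equiv B hB x.1.fst, x.2.1⟩
  map_add' x y := by
    rw [← neg_add]
    exact congrArg Neg.neg ((opA B).map_add ⟨Y.equiv B hB x.1.fst, x.2.1⟩
      ⟨Y.equiv B hB y.1.fst, y.2.1⟩)
  map_smul' c x := by
    rw [RingHom.id_apply, smul_neg]
    exact congrArg Neg.neg ((opA B).map_smul c ⟨Y.equiv B hB x.1.fst, x.2.1⟩)

/-- The operator `L (u, v) = (v, -A u)` in `X` with domain `Dom(A) × Dom(B)`. -/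
def opL : X B hB →ₗ.[𝕜] X B hB where
  domain := domL B hB
  toFun :=
    { toFun := fun x => WithLp.toLp 2 (opL₁ B hB x, opL₂ B hB x)
      map_add' := fun x y => by
        rw [← WithLp.toLp_add, Prod.mk_add_mk, map_add, map_add]
      map_smul' := fun c x => by
        rw [RingHom.id_apply, ← WithLp.toLp_smul, Prod.smul_mk, map_smul, map_smul] }

end Operators

section Semigroups

variable {𝕜 E : Type*} [RCLike 𝕜] [NormedAddCommGroup E] [NormedSpace 𝕜 E]

/-- `S : [0, ∞) → 𝓑(E)` is a strongly continuous one-parameter semigroup. -/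
structure IsC0Semigroup (S : ℝ≥0 → E →L[𝕜] E) : Prop where
  map_zero : S 0 = ContinuousLinearMap.id 𝕜 E
  map_add : ∀ t s : ℝ≥0, S (t + s) = (S t).comp (S s)
  continuous_apply : ∀ x : E, Continuous fun t => S t x

/-- `(S(t) x - x) / t → y` as `t → 0+`. -/
def HasGeneratorLimit (S : ℝ≥0 → E →L[𝕜] E) (x y : E) : Prop :=
  Tendsto (fun t : ℝ≥0 => (((t : ℝ) : 𝕜))⁻¹ • (S t x - x)) (𝓝[>] 0) (𝓝 y)

/-- `L` is the generator of `S`: its domain consists of all `x` for which the limit of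
`(S(t) x - x) / t` as `t → 0+` exists, and `L x` is that limit. -/
structure IsGenerator (S : ℝ≥0 → E →L[𝕜] E) (L : E →ₗ.[𝕜] E) : Prop where
  mem_domain_iff : ∀ x : E, x ∈ L.domain ↔ ∃ y, HasGeneratorLimit S x y
  limit_eq : ∀ x : L.domain, HasGeneratorLimit S (x : E) (L x)

variable (𝕜) in
/-- `u : [0, ∞) → E` has derivative `w` at `t` (one-sided if `t = 0`); `E` is regarded as a
real normed space by restriction of scalars. -/
def HasTimeDeriv (u : ℝ≥0 → E) (w : E) (t : ℝ≥0) : Prop :=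
  letI : NormedSpace ℝ E := NormedSpace.restrictScalars ℝ 𝕜 E
  HasDerivWithinAt (fun s : ℝ => u s.toNNReal) w (Set.Ici 0) (t : ℝ)

/-- `u` is a classical solution of `u'(t) = L u(t)` for `t > 0`, `u(0) = u₀`: it takes values in
`Dom(L)`, is continuously differentiable on `[0, ∞)` and satisfies both equations. -/
def IsClassicalSolution (L : E →ₗ.[𝕜] E) (u₀ : E) (u : ℝ≥0 → E) : Prop :=
  ∃ hu : ∀ t, u t ∈ L.domain,
    (∃ u' : ℝ≥0 → E, Continuous u' ∧ (∀ t, HasTimeDeriv 𝕜 u (u' t) t) ∧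
      ∀ t, 0 < t → u' t = L ⟨u t, hu t⟩) ∧
    u 0 = u₀

/-- The problem `u'(t) = L u(t)` for `t > 0`, `u(0) = u₀` is well-posed: each `u₀ ∈ Dom(L)` has
exactly one classical solution, and the maps `u₀ ↦ u(t)` are uniformly continuous on
`Dom(L) ⊆ E`, uniformly in `t ∈ [0, T]`, for every `T > 0`. -/
structure WellPosed (L : E →ₗ.[𝕜] E) : Prop where
  existsUnique : ∀ u₀ ∈ L.domain, ∃! u : ℝ≥0 → E, IsClassicalSolution L u₀ u
  continuous_dependence : ∀ T : ℝ≥0, 0 < T → ∀ ε : ℝ, 0 < ε → ∃ δ : ℝ, 0 < δ ∧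
    ∀ (u₀ v₀ : E) (u v : ℝ≥0 → E), IsClassicalSolution L u₀ u → IsClassicalSolution L v₀ v →
      ‖u₀ - v₀‖ < δ → ∀ t ≤ T, ‖u t - v t‖ < ε

end Semigroups

end

end AbstractWave

namespace AbstractWave

noncomputable section

/-! For the energy inner product `⟪(u,v), L(u,v)⟫ = ⟪Bu, Bv⟫ - ⟪v, B*Bu⟫` is purely imaginary
(`re_inner_opL`), so `L` is dissipative. Lower boundedness of `B` and Riesz representation in `Y`
give `L` a bounded right inverse `K` (`exists_opL_eq`). Since `(c - L)K = -(1 - cK)` and `1 - cK` is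
coercive, `c - L` is onto for every `c > 0` (`isMDissipative_opL`).

The rest is the Hille–Yosida construction: bounded approximations of `L` built from the resolvent
generate commuting contraction semigroups, which converge strongly (`cauchySeq_approx`) to a
semigroup with generator `L` (`isGenerator_semigroup`). Uniqueness and continuous dependence need no
semigroup: the distance between two classical solutions is nonincreasing
(`IsClassicalSolution.norm_sub_le`). -/

theorem isScalarTower_restrictScalars_ofReal {𝕜 E : Type*} [RCLike 𝕜] [NormedAddCommGroup E]
    [NormedSpace 𝕜 E] :
    letI : NormedSpace ℝ E := NormedSpace.restrictScalars ℝ 𝕜 E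
    IsScalarTower ℝ 𝕜 E :=
  letI : NormedSpace ℝ E := NormedSpace.restrictScalars ℝ 𝕜 E
  ⟨fun r c x => by
    rw [Algebra.smul_def, mul_smul]
    rfl⟩

/-! ### Exponentials of bounded operators -/

section BoundedExponential

variable {𝕜 E : Type*} [RCLike 𝕜] [NormedAddCommGroup E] [NormedSpace 𝕜 E] [CompleteSpace E]

theorem hasDerivAt_exp_ofReal_smul_apply [NormedSpace ℝ E] [IsScalarTower ℝ 𝕜 E]
    (A : E →L[𝕜] E) (x : E) (t : ℝ) :
    HasDerivAt (fun s : ℝ => NormedSpace.exp ((s : 𝕜) • A) x)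
      (NormedSpace.exp ((t : 𝕜) • A) (A x)) t := by
  have h1 : HasDerivAt (fun u : 𝕜 => NormedSpace.exp (u • A) x)
      (NormedSpace.exp ((t : 𝕜) • A) (A x)) (t : 𝕜) := by
    simpa using (hasDerivAt_exp_smul_const A (t : 𝕜)).clm_apply (hasDerivAt_const (t : 𝕜) x)
  have h2 : HasDerivAt (fun s : ℝ => (s : 𝕜)) 1 t := by
    simpa using (RCLike.ofRealCLM (K := 𝕜)).hasDerivAt (x := t)
  simpa [Function.comp_def] using h1.scomp t h2

theorem norm_exp_le_exp_norm (A : E →L[𝕜] E) : ‖NormedSpace.exp A‖ ≤ Real.exp ‖A‖ := by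
  have h := NormedSpace.exp_series_hasSum_exp' (𝕂 := 𝕜) A
  have hr := NormedSpace.exp_series_hasSum_exp' (𝕂 := ℝ) ‖A‖
  rw [← Real.exp_eq_exp_ℝ] at hr
  rw [← h.tsum_eq]
  refine tsum_of_norm_bounded hr fun n => ?_
  rw [norm_smul]
  simp only [norm_inv, RCLike.norm_natCast, smul_eq_mul]
  gcongr
  -- `E` may be trivial, so only `‖1‖ ≤ 1` is available for the constant term.
  rcases n with _ | n
  · simp only [pow_zero]
    exact ContinuousLinearMap.norm_id_le
  · exact norm_pow_le' A n.succ_pos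

/-- The scalar part commutes with `T` and factors out as `e^{-tc}`, which cancels the crude bound
`e^{tc}` for the exponential of `tT`. -/
theorem norm_exp_smul_sub_smul_one_le {T : E →L[𝕜] E} {c t : ℝ} (hT : ‖T‖ ≤ c) (ht : 0 ≤ t) :
    ‖NormedSpace.exp ((t : 𝕜) • (T - (c : 𝕜) • 1))‖ ≤ 1 := by
  let _ : NormedAlgebra ℚ (E →L[𝕜] E) := NormedAlgebra.restrictScalars ℚ 𝕜 _
  have h1 : (t : 𝕜) • (T - (c : 𝕜) • (1 : E →L[𝕜] E))
      = (t : 𝕜) • T + algebraMap 𝕜 (E →L[𝕜] E) ((-(t * c) : ℝ) : 𝕜) := by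
    rw [Algebra.algebraMap_eq_smul_one, smul_sub, smul_smul]
    push_cast
    rw [neg_smul, sub_eq_add_neg]
  rw [h1, NormedSpace.exp_add_of_commute (Algebra.commutes _ _).symm,
    ← NormedSpace.algebraMap_exp_comm, Algebra.algebraMap_eq_smul_one, mul_smul_one, norm_smul]
  have h2 : ‖NormedSpace.exp ((-(t * c) : ℝ) : 𝕜)‖ = Real.exp (-(t * c)) := by
    have := NormedSpace.algebraMap_exp_comm (𝕂 := ℝ) (𝔸 := 𝕜) (-(t * c))
    rw [← Real.exp_eq_exp_ℝ, RCLike.algebraMap_eq_ofReal] at this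
    rw [← this, RCLike.norm_ofReal, abs_of_pos (Real.exp_pos _)]
  rw [h2]
  calc Real.exp (-(t * c)) * ‖NormedSpace.exp ((t : 𝕜) • T)‖
      ≤ Real.exp (-(t * c)) * Real.exp (t * c) := by
        gcongr
        refine (norm_exp_le_exp_norm _).trans ?_
        rw [norm_smul, RCLike.norm_ofReal, abs_of_nonneg ht]
        gcongr
    _ = 1 := by rw [← Real.exp_add]; simp

/-- Interpolate along `s ↦ exp(sA) exp((t-s)B) x`: its derivative is two contractions applied to `(A
- B)x`. By commutativity the path equals `exp(s(A-B)) exp(tB) x`, in which only one factor depends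
on `s`. -/
theorem norm_exp_smul_sub_exp_smul_le {A B : E →L[𝕜] E} (hAB : Commute A B)
    (hA : ∀ t : ℝ, 0 ≤ t → ‖NormedSpace.exp ((t : 𝕜) • A)‖ ≤ 1)
    (hB : ∀ t : ℝ, 0 ≤ t → ‖NormedSpace.exp ((t : 𝕜) • B)‖ ≤ 1) {t : ℝ} (ht : 0 ≤ t) (x : E) :
    ‖NormedSpace.exp ((t : 𝕜) • A) x - NormedSpace.exp ((t : 𝕜) • B) x‖ ≤ t * ‖A x - B x‖ := by
  let _ : NormedAlgebra ℚ (E →L[𝕜] E) := NormedAlgebra.restrictScalars ℚ 𝕜 _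
  let _ : NormedSpace ℝ E := NormedSpace.restrictScalars ℝ 𝕜 E
  have : IsScalarTower ℝ 𝕜 E := isScalarTower_restrictScalars_ofReal
  have key (s : ℝ) : NormedSpace.exp ((s : 𝕜) • (A - B)) * NormedSpace.exp ((t : 𝕜) • B)
      = NormedSpace.exp ((s : 𝕜) • A) * NormedSpace.exp (((t - s : ℝ) : 𝕜) • B) := by
    have c1 : Commute ((s : 𝕜) • (A - B)) ((t : 𝕜) • B) :=
      ((hAB.sub_left (Commute.refl B)).smul_left _).smul_right _
    have c2 : Commute ((s : 𝕜) • A) (((t - s : ℝ) : 𝕜) • B) := (hAB.smul_left _).smul_right _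
    rw [← NormedSpace.exp_add_of_commute c1, ← NormedSpace.exp_add_of_commute c2]
    congr 1
    push_cast
    module
  have hd (s : ℝ) := hasDerivAt_exp_ofReal_smul_apply (A - B) (NormedSpace.exp ((t : 𝕜) • B) x) s
  have hc : Commute (A - B) (NormedSpace.exp ((t : 𝕜) • B)) :=
    ((hAB.sub_left (Commute.refl B)).smul_right _).exp_right
  have hbound (s : ℝ) (hs : s ∈ Set.Ico 0 t) : ‖NormedSpace.exp ((s : 𝕜) • (A - B))
      ((A - B) (NormedSpace.exp ((t : 𝕜) • B) x))‖ ≤ ‖A x - B x‖ := by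
    have e1 : (A - B) (NormedSpace.exp ((t : 𝕜) • B) x)
        = NormedSpace.exp ((t : 𝕜) • B) ((A - B) x) := congrArg (fun T => T x) hc.eq
    have e2 := congrArg (fun T : E →L[𝕜] E => T ((A - B) x)) (key s)
    simp only [mul_apply_eq_comp] at e2
    rw [e1, e2]
    refine ((NormedSpace.exp ((s : 𝕜) • A)).le_of_opNorm_le (hA s hs.1) _).trans ?_
    rw [one_mul]
    refine ((NormedSpace.exp (((t - s : ℝ) : 𝕜) • B)).le_of_opNorm_le
      (hB _ (sub_nonneg.2 hs.2.le)) _).trans ?_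
    rw [one_mul, sub_apply]
  have h := norm_image_sub_le_of_norm_deriv_le_segment' (a := 0) (b := t)
    (fun s _ => (hd s).hasDerivWithinAt) hbound t ⟨ht, le_rfl⟩
  have e3 := congrArg (fun T : E →L[𝕜] E => T x) (key t)
  simp only [mul_apply_eq_comp] at e3
  rw [e3] at h
  simpa [mul_comm] using h

end BoundedExponential

/-- A densely defined dissipative operator `L` for which `c - L` is onto for every `c > 0`. -/
structure IsMDissipative {𝕜 E : Type*} [RCLike 𝕜] [NormedAddCommGroup E] [NormedSpace 𝕜 E]
    (L : E →ₗ.[𝕜] E) : Prop where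
  dense : Dense (L.domain : Set E)
  norm_le : ∀ c : ℝ, 0 < c → ∀ x : L.domain, c * ‖(x : E)‖ ≤ ‖(c : 𝕜) • (x : E) - L x‖
  exists_eq : ∀ c : ℝ, 0 < c → ∀ y : E, ∃ x : L.domain, (c : 𝕜) • (x : E) - L x = y

namespace IsMDissipative

/-! ### Resolvents and Yosida approximations -/

section Resolvent

variable {𝕜 E : Type*} [RCLike 𝕜] [NormedAddCommGroup E] [NormedSpace 𝕜 E]
  {L : E →ₗ.[𝕜] E} (hL : IsMDissipative L)

include hL in
theorem bijective {c : ℝ} (hc : 0 < c) :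
    Function.Bijective ((c : 𝕜) • L.domain.subtype - L.toFun) := by
  refine ⟨(injective_iff_map_eq_zero _).2 fun x hx => ?_, hL.exists_eq c hc⟩
  have h1 := hL.norm_le c hc x
  have h2 : (c : 𝕜) • (x : E) - L x = 0 := hx
  rw [h2, norm_zero] at h1
  have h3 : ‖(x : E)‖ = 0 := by
    by_contra h4
    have : 0 < ‖(x : E)‖ := by positivity
    nlinarith
  exact Subtype.ext (norm_eq_zero.mp h3)

/-- The inverse of `c - L`, with values in the domain of `L`. -/
def resolventAux {c : ℝ} (hc : 0 < c) : E →ₗ[𝕜] L.domain :=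
  (LinearEquiv.ofBijective _ (hL.bijective hc)).symm.toLinearMap

theorem resolventAux_spec {c : ℝ} (hc : 0 < c) (y : E) :
    (c : 𝕜) • (hL.resolventAux hc y : E) - L (hL.resolventAux hc y) = y :=
  (LinearEquiv.ofBijective _ (hL.bijective hc)).apply_symm_apply y

theorem resolventAux_sub {c : ℝ} (hc : 0 < c) (x : L.domain) :
    hL.resolventAux hc ((c : 𝕜) • (x : E) - L x) = x :=
  (LinearEquiv.ofBijective _ (hL.bijective hc)).symm_apply_apply x

/-- The resolvent `(c - L)⁻¹` as a bounded operator. -/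
def resolvent {c : ℝ} (hc : 0 < c) : E →L[𝕜] E :=
  LinearMap.mkContinuous (L.domain.subtype ∘ₗ hL.resolventAux hc) c⁻¹ fun y => by
    have h := hL.norm_le c hc (hL.resolventAux hc y)
    rw [resolventAux_spec] at h
    rwa [inv_mul_eq_div, le_div_iff₀' hc]

theorem norm_resolvent_le {c : ℝ} (hc : 0 < c) : ‖hL.resolvent hc‖ ≤ c⁻¹ :=
  LinearMap.mkContinuous_norm_le _ (inv_nonneg.2 hc.le) _

theorem resolvent_mem {c : ℝ} (hc : 0 < c) (y : E) : hL.resolvent hc y ∈ L.domain :=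
  (hL.resolventAux hc y).2

theorem apply_resolvent {c : ℝ} (hc : 0 < c) (y : E) :
    L ⟨hL.resolvent hc y, hL.resolvent_mem hc y⟩ = (c : 𝕜) • hL.resolvent hc y - y := by
  rw [eq_sub_iff_add_eq, ← eq_sub_iff_add_eq']
  exact (hL.resolventAux_spec hc y).symm

theorem resolvent_sub {c : ℝ} (hc : 0 < c) (x : L.domain) :
    hL.resolvent hc ((c : 𝕜) • (x : E) - L x) = x :=
  congrArg Subtype.val (hL.resolventAux_sub hc x)

theorem resolvent_apply_op {c : ℝ} (hc : 0 < c) (x : L.domain) :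
    hL.resolvent hc (L x) = (c : 𝕜) • hL.resolvent hc x - (x : E) := by
  have h := hL.resolvent_sub hc x
  rw [map_sub, map_smul, sub_eq_iff_eq_add, ← sub_eq_iff_eq_add'] at h
  exact h.symm

/-- With `z = R_d y`, evaluating `R_c (L z)` in two ways gives `(d - L) R_c z = R_c y`; applying
`R_d` finishes. -/
theorem commute_resolvent {c d : ℝ} (hc : 0 < c) (hd : 0 < d) :
    Commute (hL.resolvent hc) (hL.resolvent hd) := by
  ext y
  change hL.resolvent hc (hL.resolvent hd y) = hL.resolvent hd (hL.resolvent hc y)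
  set z : E := hL.resolvent hd y with hz
  have hzL := hL.apply_resolvent hd y
  have h1 := hL.resolvent_apply_op hc ⟨z, hL.resolvent_mem hd y⟩
  rw [hzL] at h1
  have h2 := hL.resolvent_sub hd ⟨hL.resolvent hc z, hL.resolvent_mem hc z⟩
  rw [hL.apply_resolvent hc z] at h2
  simp only [map_sub, map_smul, ← hz] at h1
  have h3 : (c : 𝕜) • hL.resolvent hc z - z = (d : 𝕜) • hL.resolvent hc z - hL.resolvent hc y :=
    h1.symm
  rw [h3, sub_sub_cancel] at h2
  exact h2.symm

/-- The Yosida approximation `(n+1) ((n+1) R - 1)`, where `R` is the resolvent at `n+1`. -/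
def yosida (n : ℕ) : E →L[𝕜] E :=
  (((n + 1 : ℝ) ^ 2 : ℝ) : 𝕜) • hL.resolvent (Nat.cast_add_one_pos n : (0 : ℝ) < n + 1)
    - ((n + 1 : ℝ) : 𝕜) • 1

/-- On the domain the approximation is a contraction following `L`, which yields both the uniform
bound and the convergence to `L x`. -/
theorem yosida_apply (n : ℕ) (x : L.domain) :
    hL.yosida n x = ((n + 1 : ℝ) : 𝕜) •
      hL.resolvent (Nat.cast_add_one_pos n : (0 : ℝ) < n + 1) (L x) := by
  rw [resolvent_apply_op]
  simp [yosida, sq, smul_sub, smul_smul]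

theorem commute_resolvent_yosida {c : ℝ} (hc : 0 < c) (n : ℕ) :
    Commute (hL.resolvent hc) (hL.yosida n) :=
  ((hL.commute_resolvent hc _).smul_right _).sub_right ((Commute.one_right _).smul_right _)

theorem commute_yosida (m n : ℕ) : Commute (hL.yosida m) (hL.yosida n) :=
  ((hL.commute_resolvent_yosida _ n).smul_left _).sub_left ((Commute.one_left _).smul_left _)

theorem norm_smul_resolvent_le (n : ℕ) :
    ‖((n + 1 : ℝ) : 𝕜) • hL.resolvent (Nat.cast_add_one_pos n : (0 : ℝ) < n + 1)‖ ≤ 1 := by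
  have hn : (0 : ℝ) < n + 1 := Nat.cast_add_one_pos n
  rw [norm_smul, RCLike.norm_ofReal, abs_of_pos hn]
  calc (n + 1 : ℝ) * _ ≤ (n + 1 : ℝ) * (n + 1 : ℝ)⁻¹ := by
        gcongr
        exact hL.norm_resolvent_le hn
    _ = 1 := mul_inv_cancel₀ hn.ne'

theorem norm_yosida_apply_le (n : ℕ) (x : L.domain) : ‖hL.yosida n x‖ ≤ ‖L x‖ := by
  rw [yosida_apply]
  simpa using (((n + 1 : ℝ) : 𝕜) • hL.resolvent
    (Nat.cast_add_one_pos n : (0 : ℝ) < n + 1)).le_of_opNorm_le (hL.norm_smul_resolvent_le n) (L x)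

/-- On the domain the error is `R(Lx)`, of size at most `‖Lx‖/(n+1)`; density and uniform
contractivity extend this to all of `E`. -/
theorem tendsto_smul_resolvent (y : E) :
    Tendsto (fun n : ℕ => ((n + 1 : ℝ) : 𝕜) •
      hL.resolvent (Nat.cast_add_one_pos n : (0 : ℝ) < n + 1) y) atTop (𝓝 y) := by
  rw [Metric.tendsto_atTop]
  intro ε hε
  obtain ⟨x, hx, hxy⟩ := Metric.mem_closure_iff.1 (hL.dense y) (ε / 3) (by positivity)
  obtain ⟨N, hN⟩ := exists_nat_gt (‖L ⟨x, hx⟩‖ / (ε / 3))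
  refine ⟨N, fun n hn => ?_⟩
  have hn0 : (0 : ℝ) < n + 1 := Nat.cast_add_one_pos n
  set R := ((n + 1 : ℝ) : 𝕜) • hL.resolvent hn0 with hR
  have hR1 : ‖R‖ ≤ 1 := hL.norm_smul_resolvent_le n
  have h1 : R x - x = hL.resolvent hn0 (L ⟨x, hx⟩) := by
    rw [resolvent_apply_op]; rfl
  have h2 : ‖R x - x‖ < ε / 3 := by
    rw [h1]
    refine ((hL.resolvent hn0).le_of_opNorm_le (hL.norm_resolvent_le hn0) _).trans_lt ?_
    rw [inv_mul_lt_iff₀ hn0]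
    rw [div_lt_iff₀ (by positivity)] at hN
    refine hN.trans_le ?_
    gcongr
    have : (N : ℝ) ≤ n := by exact_mod_cast hn
    linarith
  have h3 : ‖R (y - x)‖ ≤ ‖y - x‖ := by simpa using R.le_of_opNorm_le hR1 (y - x)
  rw [dist_eq_norm] at hxy ⊢
  calc ‖R y - y‖ = ‖R (y - x) + (R x - x) - (y - x)‖ := by rw [map_sub]; congr 1; abel
    _ ≤ ‖R (y - x)‖ + ‖R x - x‖ + ‖y - x‖ :=
      (norm_sub_le _ _).trans (by gcongr; exact norm_add_le _ _)
    _ < ε := by linarith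

theorem tendsto_yosida (x : L.domain) :
    Tendsto (fun n : ℕ => hL.yosida n x) atTop (𝓝 (L x)) := by
  simp only [yosida_apply]
  exact hL.tendsto_smul_resolvent (L x)

end Resolvent

/-! ### The semigroup as a strong limit -/

section Semigroup

variable {𝕜 E : Type*} [RCLike 𝕜] [NormedAddCommGroup E] [NormedSpace 𝕜 E]
  {L : E →ₗ.[𝕜] E} (hL : IsMDissipative L)

/-- The uniformly continuous semigroup generated by a Yosida approximation. -/
def approx (n : ℕ) (t : ℝ≥0) : E →L[𝕜] E := NormedSpace.exp (((t : ℝ) : 𝕜) • hL.yosida n)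

theorem approx_zero (n : ℕ) : hL.approx n 0 = 1 := by simp [approx]

theorem commute_resolvent_approx {c : ℝ} (hc : 0 < c) (n : ℕ) (t : ℝ≥0) :
    Commute (hL.resolvent hc) (hL.approx n t) := by
  let _ : NormedAlgebra ℚ (E →L[𝕜] E) := NormedAlgebra.restrictScalars ℚ 𝕜 _
  exact ((hL.commute_resolvent_yosida hc n).smul_right _).exp_right

variable [CompleteSpace E]

theorem norm_exp_yosida_le (n : ℕ) {t : ℝ} (ht : 0 ≤ t) :
    ‖NormedSpace.exp ((t : 𝕜) • hL.yosida n)‖ ≤ 1 := by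
  refine norm_exp_smul_sub_smul_one_le ?_ ht
  have hn : (0 : ℝ) < n + 1 := Nat.cast_add_one_pos n
  rw [norm_smul, RCLike.norm_ofReal, abs_of_pos (by positivity)]
  calc ((n : ℝ) + 1) ^ 2 * _ ≤ ((n : ℝ) + 1) ^ 2 * (n + 1 : ℝ)⁻¹ := by
        gcongr
        exact hL.norm_resolvent_le hn
    _ = (n : ℝ) + 1 := by field_simp

theorem norm_approx_le (n : ℕ) (t : ℝ≥0) : ‖hL.approx n t‖ ≤ 1 := hL.norm_exp_yosida_le n t.2

theorem norm_approx_apply_le (n : ℕ) (t : ℝ≥0) (x : E) : ‖hL.approx n t x‖ ≤ ‖x‖ := by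
  simpa using (hL.approx n t).le_of_opNorm_le (hL.norm_approx_le n t) x

theorem norm_approx_sub_approx_le (m n : ℕ) (t : ℝ≥0) (x : E) :
    ‖hL.approx m t x - hL.approx n t x‖ ≤ t * ‖hL.yosida m x - hL.yosida n x‖ :=
  norm_exp_smul_sub_exp_smul_le (hL.commute_yosida m n) (fun _ => hL.norm_exp_yosida_le m)
    (fun _ => hL.norm_exp_yosida_le n) t.2 x

theorem approx_add (n : ℕ) (t s : ℝ≥0) :
    hL.approx n (t + s) = hL.approx n t * hL.approx n s := by
  let _ : NormedAlgebra ℚ (E →L[𝕜] E) := NormedAlgebra.restrictScalars ℚ 𝕜 _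
  rw [approx, approx, approx, ← NormedSpace.exp_add_of_commute
    (((Commute.refl _).smul_left _).smul_right _), ← add_smul]
  push_cast
  rfl

/-- Comparison with the semigroup of the zero operator. -/
theorem norm_approx_sub_self_le (n : ℕ) (t : ℝ≥0) (x : E) :
    ‖hL.approx n t x - x‖ ≤ t * ‖hL.yosida n x‖ := by
  simpa [approx] using norm_exp_smul_sub_exp_smul_le (Commute.zero_right (hL.yosida n))
    (fun _ => hL.norm_exp_yosida_le n) (fun s _ => by
      rw [smul_zero, NormedSpace.exp_zero]
      exact ContinuousLinearMap.norm_id_le) t.2 x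

/-- On the domain, differences of approximants are controlled by differences of the convergent
sequence `yosida n y`; a three-epsilon argument does the rest. -/
theorem cauchySeq_approx (t : ℝ≥0) (x : E) : CauchySeq fun n => hL.approx n t x := by
  rw [Metric.cauchySeq_iff]
  intro ε hε
  obtain ⟨y, hy, hxy⟩ := Metric.mem_closure_iff.1 (hL.dense x) (ε / 3) (by positivity)
  have hc := (hL.tendsto_yosida ⟨y, hy⟩).cauchySeq
  rw [Metric.cauchySeq_iff] at hc
  obtain ⟨N, hN⟩ := hc (ε / 3 / (t + 1)) (by positivity)
  refine ⟨N, fun m hm n hn => ?_⟩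
  have h1 := hN m hm n hn
  rw [dist_eq_norm] at h1 hxy ⊢
  have h2 : ‖hL.approx m t y - hL.approx n t y‖ ≤ ε / 3 := by
    refine (hL.norm_approx_sub_approx_le m n t y).trans ?_
    calc (t : ℝ) * _ ≤ (t + 1 : ℝ) * (ε / 3 / (t + 1)) := by
          gcongr
          linarith
      _ = ε / 3 := by field_simp
  have h3 := hL.norm_approx_apply_le m t (x - y)
  have h4 := hL.norm_approx_apply_le n t (x - y)
  calc ‖hL.approx m t x - hL.approx n t x‖
      = ‖hL.approx m t (x - y) + (hL.approx m t y - hL.approx n t y) - hL.approx n t (x - y)‖ := by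
        rw [map_sub, map_sub]; congr 1; abel
    _ ≤ ‖hL.approx m t (x - y)‖ + ‖hL.approx m t y - hL.approx n t y‖
        + ‖hL.approx n t (x - y)‖ :=
      (norm_sub_le _ _).trans (by gcongr; exact norm_add_le _ _)
    _ < ε := by linarith

theorem exists_semigroup (t : ℝ≥0) :
    ∃ T : E →L[𝕜] E, ∀ x, Tendsto (fun n => hL.approx n t x) atTop (𝓝 (T x)) := by
  choose f hf using fun x => cauchySeq_tendsto_of_complete (hL.cauchySeq_approx t x)
  let T : E →ₗ[𝕜] E := linearMapOfTendsto f (fun n => (hL.approx n t).toLinearMap)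
    (tendsto_pi_nhds.2 hf)
  refine ⟨T.mkContinuous 1 fun x => ?_, hf⟩
  rw [one_mul]
  exact le_of_tendsto (hf x).norm (Eventually.of_forall fun n => hL.norm_approx_apply_le n t x)

/-- The contraction semigroup generated by `L`. -/
def semigroup (t : ℝ≥0) : E →L[𝕜] E := (hL.exists_semigroup t).choose

theorem tendsto_approx (t : ℝ≥0) (x : E) :
    Tendsto (fun n => hL.approx n t x) atTop (𝓝 (hL.semigroup t x)) :=
  (hL.exists_semigroup t).choose_spec x

theorem norm_semigroup_apply_le (t : ℝ≥0) (x : E) : ‖hL.semigroup t x‖ ≤ ‖x‖ :=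
  le_of_tendsto (hL.tendsto_approx t x).norm
    (Eventually.of_forall fun n => hL.norm_approx_apply_le n t x)

theorem norm_semigroup_le (t : ℝ≥0) : ‖hL.semigroup t‖ ≤ 1 :=
  ContinuousLinearMap.opNorm_le_bound _ zero_le_one fun x => by
    simpa using hL.norm_semigroup_apply_le t x

theorem tendsto_approx_of_tendsto (t : ℝ≥0) {u : ℕ → E} {x : E} (hu : Tendsto u atTop (𝓝 x)) :
    Tendsto (fun n => hL.approx n t (u n)) atTop (𝓝 (hL.semigroup t x)) := by
  have h1 : Tendsto (fun n => hL.approx n t (u n - x)) atTop (𝓝 0) :=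
    squeeze_zero_norm (fun n => hL.norm_approx_apply_le n t (u n - x))
      (tendsto_iff_norm_sub_tendsto_zero.1 hu)
  simpa using h1.add (hL.tendsto_approx t x)

theorem semigroup_zero : hL.semigroup 0 = ContinuousLinearMap.id 𝕜 E := by
  ext x
  refine tendsto_nhds_unique (hL.tendsto_approx 0 x) ?_
  simp [approx_zero]

theorem semigroup_add (t s : ℝ≥0) :
    hL.semigroup (t + s) = (hL.semigroup t).comp (hL.semigroup s) := by
  ext x
  refine tendsto_nhds_unique (hL.tendsto_approx (t + s) x) ?_
  simp only [approx_add]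
  exact hL.tendsto_approx_of_tendsto t (hL.tendsto_approx s x)

theorem norm_semigroup_sub_self_le (t : ℝ≥0) (x : L.domain) :
    ‖hL.semigroup t x - x‖ ≤ t * ‖L x‖ := by
  refine le_of_tendsto ((hL.tendsto_approx t x).sub_const (x : E)).norm
    (Eventually.of_forall fun n => ?_)
  refine (hL.norm_approx_sub_self_le n t x).trans ?_
  gcongr
  exact hL.norm_yosida_apply_le n x

theorem norm_semigroup_sub_semigroup_le (t s : ℝ≥0) (x : L.domain) :
    ‖hL.semigroup t x - hL.semigroup s x‖ ≤ ‖L x‖ * dist t s := by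
  wlog h : s ≤ t generalizing s t
  · rw [norm_sub_rev, dist_comm]
    exact this s t (le_of_not_ge h)
  obtain ⟨r, rfl⟩ := exists_add_of_le h
  rw [semigroup_add, ContinuousLinearMap.comp_apply, ← map_sub]
  refine (hL.norm_semigroup_apply_le s _).trans ((hL.norm_semigroup_sub_self_le r x).trans_eq ?_)
  rw [mul_comm, NNReal.dist_eq]
  simp

theorem continuous_semigroup_apply (x : E) : Continuous fun t => hL.semigroup t x := by
  rw [Metric.continuous_iff]
  intro s ε hε
  obtain ⟨y, hy, hxy⟩ := Metric.mem_closure_iff.1 (hL.dense x) (ε / 3) (by positivity)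
  refine ⟨ε / 3 / (‖L ⟨y, hy⟩‖ + 1), by positivity, fun t ht => ?_⟩
  have h1 := hL.norm_semigroup_sub_semigroup_le t s ⟨y, hy⟩
  have h2 : ‖L ⟨y, hy⟩‖ * dist t s ≤ ε / 3 := by
    calc ‖L ⟨y, hy⟩‖ * dist t s ≤ (‖L ⟨y, hy⟩‖ + 1) * (ε / 3 / (‖L ⟨y, hy⟩‖ + 1)) := by
          gcongr
          linarith
      _ = ε / 3 := by field_simp
  have h3 := hL.norm_semigroup_apply_le t (x - y)
  have h4 := hL.norm_semigroup_apply_le s (x - y)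
  rw [dist_eq_norm] at hxy ⊢
  calc ‖hL.semigroup t x - hL.semigroup s x‖
      = ‖hL.semigroup t (x - y) + (hL.semigroup t y - hL.semigroup s y)
          - hL.semigroup s (x - y)‖ := by
        rw [map_sub, map_sub]; congr 1; abel
    _ ≤ ‖hL.semigroup t (x - y)‖ + ‖hL.semigroup t y - hL.semigroup s y‖
        + ‖hL.semigroup s (x - y)‖ :=
      (norm_sub_le _ _).trans (by gcongr; exact norm_add_le _ _)
    _ < ε := by linarith [h1.trans h2]

theorem isC0Semigroup_semigroup : IsC0Semigroup hL.semigroup :=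
  ⟨hL.semigroup_zero, hL.semigroup_add, hL.continuous_semigroup_apply⟩

/-- This yields invariance of the domain without differentiating: the semigroup maps the range of
the resolvent, which is the domain, into itself. -/
theorem resolvent_semigroup {c : ℝ} (hc : 0 < c) (t : ℝ≥0) (x : E) :
    hL.resolvent hc (hL.semigroup t x) = hL.semigroup t (hL.resolvent hc x) := by
  refine tendsto_nhds_unique
    (((hL.resolvent hc).continuous.tendsto _).comp (hL.tendsto_approx t x)) ?_
  refine (hL.tendsto_approx t (hL.resolvent hc x)).congr fun n => ?_
  exact congrArg (fun T : E →L[𝕜] E => T x) (hL.commute_resolvent_approx hc n t).eq.symm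

theorem exists_apply_semigroup (t : ℝ≥0) (x : L.domain) :
    ∃ h : hL.semigroup t x ∈ L.domain, L ⟨hL.semigroup t x, h⟩ = hL.semigroup t (L x) := by
  have h1 : (0 : ℝ) < 1 := one_pos
  have h2 : hL.semigroup t x
      = hL.resolvent h1 (hL.semigroup t (((1 : ℝ) : 𝕜) • (x : E) - L x)) := by
    rw [resolvent_semigroup, resolvent_sub]
  refine ⟨h2 ▸ hL.resolvent_mem h1 _, ?_⟩
  have h3 := hL.apply_resolvent h1 (hL.semigroup t (((1 : ℝ) : 𝕜) • (x : E) - L x))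
  simp only [← h2] at h3
  rw [h3, map_sub, map_smul, sub_sub_cancel]

/-- Limit of the fundamental theorem of calculus for the approximants, whose integrands are all
bounded by the constant `‖Lx‖`. -/
theorem semigroup_sub_eq_integral [NormedSpace ℝ E] [IsScalarTower ℝ 𝕜 E] (t : ℝ≥0)
    (x : L.domain) :
    hL.semigroup t x - x = ∫ s in (0 : ℝ)..t, hL.semigroup s.toNNReal (L x) := by
  have hcont (n : ℕ) (y : E) :
      Continuous fun s : ℝ => NormedSpace.exp ((s : 𝕜) • hL.yosida n) y :=
    continuous_iff_continuousAt.2 fun s =>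
      (hasDerivAt_exp_ofReal_smul_apply (hL.yosida n) y s).continuousAt
  have h1 (n : ℕ) : hL.approx n t x - x
      = ∫ s in (0 : ℝ)..t, hL.approx n s.toNNReal (hL.yosida n x) := by
    have h := intervalIntegral.integral_eq_sub_of_hasDerivAt (a := 0) (b := (t : ℝ))
      (fun s _ => hasDerivAt_exp_ofReal_smul_apply (hL.yosida n) (x : E) s)
      ((hcont n _).intervalIntegrable _ _)
    simp only [RCLike.ofReal_zero, zero_smul, NormedSpace.exp_zero] at h
    refine h.symm.trans (intervalIntegral.integral_congr fun s hs => ?_)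
    rw [Set.uIcc_of_le t.coe_nonneg] at hs
    simp only [approx, Real.coe_toNNReal s hs.1]
  refine tendsto_nhds_unique ((hL.tendsto_approx t x).sub_const (x : E)) ?_
  simp only [h1]
  refine intervalIntegral.tendsto_integral_filter_of_dominated_convergence (fun _ => ‖L x‖)
    (Eventually.of_forall fun n => ?_) (Eventually.of_forall fun n => ?_) (by simp) ?_
  · have : Continuous fun s : ℝ => hL.approx n s.toNNReal (hL.yosida n x) := by
      have h := (hcont n (hL.yosida n x)).comp (NNReal.continuous_coe.comp continuous_real_toNNReal)
      exact h
    exact this.aestronglyMeasurable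
  · exact Eventually.of_forall fun s _ => (hL.norm_approx_apply_le n _ _).trans
      (hL.norm_yosida_apply_le n x)
  · exact Eventually.of_forall fun s _ => hL.tendsto_approx_of_tendsto _ (hL.tendsto_yosida x)

theorem hasTimeDeriv_semigroup (x : L.domain) (t : ℝ≥0) :
    HasTimeDeriv 𝕜 (fun s => hL.semigroup s x) (hL.semigroup t (L x)) t := by
  let _ : NormedSpace ℝ E := NormedSpace.restrictScalars ℝ 𝕜 E
  have _ : IsScalarTower ℝ 𝕜 E := isScalarTower_restrictScalars_ofReal
  have hc : Continuous fun s : ℝ => hL.semigroup s.toNNReal (L x) :=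
    (hL.continuous_semigroup_apply (L x)).comp continuous_real_toNNReal
  have h := (intervalIntegral.integral_hasDerivAt_right (hc.intervalIntegrable 0 t)
    (hc.stronglyMeasurableAtFilter _ _) hc.continuousAt).const_add (x : E)
  simp only [Real.toNNReal_coe] at h
  refine h.hasDerivWithinAt.congr (fun s hs => ?_) ?_
  · have := hL.semigroup_sub_eq_integral s.toNNReal x
    rw [Real.coe_toNNReal s hs] at this
    rw [← this, add_sub_cancel]
  · have := hL.semigroup_sub_eq_integral t x
    rw [← this, add_sub_cancel, Real.toNNReal_coe]

end Semigroup

/-! ### Identification of the generator -/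

section Generator

variable {𝕜 E : Type*} [RCLike 𝕜] [NormedAddCommGroup E] [NormedSpace 𝕜 E]

theorem _root_.AbstractWave.HasTimeDeriv.hasGeneratorLimit {S : ℝ≥0 → E →L[𝕜] E}
    (hS : S 0 = ContinuousLinearMap.id 𝕜 E) {x y : E}
    (h : HasTimeDeriv 𝕜 (fun t => S t x) y 0) : HasGeneratorLimit S x y := by
  let _ : NormedSpace ℝ E := NormedSpace.restrictScalars ℝ 𝕜 E
  have h1 := hasDerivWithinAt_iff_tendsto_slope.1 h
  have h2 : Tendsto (fun t : ℝ≥0 => (t : ℝ)) (𝓝[>] 0)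
      (𝓝[Set.Ici 0 \ {((0 : ℝ≥0) : ℝ)}] ((0 : ℝ≥0) : ℝ)) := by
    refine tendsto_nhdsWithin_iff.2 ⟨(NNReal.continuous_coe.tendsto 0).mono_left
      nhdsWithin_le_nhds, ?_⟩
    filter_upwards [self_mem_nhdsWithin] with t ht
    exact ⟨t.2, fun h0 => (ne_of_gt ht) (NNReal.coe_injective h0)⟩
  refine (h1.comp h2).congr fun t => ?_
  simp only [Function.comp_apply, slope_def_module, Real.toNNReal_coe, hS, NNReal.coe_zero,
    sub_zero, Real.toNNReal_zero, ContinuousLinearMap.id_apply]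
  change (algebraMap ℝ 𝕜 (t : ℝ)⁻¹) • (S t x - x) = _
  simp

theorem _root_.AbstractWave.HasGeneratorLimit.sub {S : ℝ≥0 → E →L[𝕜] E} {x y x' y' : E}
    (h : HasGeneratorLimit S x y) (h' : HasGeneratorLimit S x' y') :
    HasGeneratorLimit S (x - x') (y - y') := by
  refine (Tendsto.sub h h').congr fun t => ?_
  rw [map_sub, ← smul_sub]
  congr 1
  abel

/-- Contractivity gives `‖S(t)x - (1+t)x‖ ≥ t‖x‖`, so the difference quotient stays at distance at
least `‖x‖` from `x`. -/
theorem _root_.AbstractWave.HasGeneratorLimit.eq_zero_of_self {S : ℝ≥0 → E →L[𝕜] E}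
    (hS : ∀ t x, ‖S t x‖ ≤ ‖x‖) {x : E} (h : HasGeneratorLimit S x x) : x = 0 := by
  have h1 : Tendsto (fun t : ℝ≥0 => ‖(((t : ℝ) : 𝕜))⁻¹ • (S t x - x) - x‖) (𝓝[>] 0) (𝓝 0) := by
    simpa using (Tendsto.sub_const h x).norm
  have h2 : ‖x‖ ≤ 0 := by
    refine ge_of_tendsto h1 ?_
    filter_upwards [self_mem_nhdsWithin] with t ht
    have ht0 : (0 : ℝ) < t := ht
    have ht1 : ((t : ℝ) : 𝕜) ≠ 0 := RCLike.ofReal_ne_zero.2 ht0.ne'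
    have e : ((t : ℝ) : 𝕜) • ((((t : ℝ) : 𝕜))⁻¹ • (S t x - x) - x)
        = S t x - ((1 + t : ℝ) : 𝕜) • x := by
      rw [smul_sub, smul_inv_smul₀ ht1]
      push_cast
      module
    have h3 : (t : ℝ) * ‖(((t : ℝ) : 𝕜))⁻¹ • (S t x - x) - x‖
        = ‖S t x - ((1 + t : ℝ) : 𝕜) • x‖ := by
      rw [← e, norm_smul, RCLike.norm_ofReal, abs_of_pos ht0]
    have h4 : (1 + t : ℝ) * ‖x‖ - ‖S t x‖ ≤ ‖S t x - ((1 + t : ℝ) : 𝕜) • x‖ := by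
      have := norm_sub_norm_le (((1 + t : ℝ) : 𝕜) • x) (S t x)
      rwa [norm_smul, RCLike.norm_ofReal, abs_of_pos (by positivity), norm_sub_rev] at this
    have h5 := hS t x
    rw [← h3] at h4
    by_contra! h6
    nlinarith
  exact norm_le_zero_iff.1 h2

variable [CompleteSpace E] {L : E →ₗ.[𝕜] E} (hL : IsMDissipative L)

theorem hasGeneratorLimit_semigroup (x : L.domain) :
    HasGeneratorLimit hL.semigroup (x : E) (L x) := by
  refine HasTimeDeriv.hasGeneratorLimit hL.semigroup_zero ?_
  have h := hL.hasTimeDeriv_semigroup x 0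
  rwa [semigroup_zero, ContinuousLinearMap.id_apply] at h

theorem isGenerator_semigroup : IsGenerator hL.semigroup L where
  limit_eq := hL.hasGeneratorLimit_semigroup
  mem_domain_iff x := by
    refine ⟨fun hx => ⟨_, hL.hasGeneratorLimit_semigroup ⟨x, hx⟩⟩, fun ⟨y, hy⟩ => ?_⟩
    -- Maximality: the choice `z - Lz = x - y` makes `x - z` its own generator limit, hence zero, so
    -- `x` lies in the domain.
    obtain ⟨z, hz⟩ := hL.exists_eq 1 one_pos (x - y)
    have h := hy.sub (hL.hasGeneratorLimit_semigroup z)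
    have e : y - L z = x - z := by
      rw [RCLike.ofReal_one, one_smul, sub_eq_sub_iff_add_eq_add] at hz
      rw [sub_eq_sub_iff_add_eq_add, ← hz, add_comm]
    rw [e] at h
    have h0 := h.eq_zero_of_self hL.norm_semigroup_apply_le
    rw [sub_eq_zero] at h0
    exact h0 ▸ z.2

theorem isClassicalSolution_semigroup {x : E} (hx : x ∈ L.domain) :
    IsClassicalSolution L x fun t => hL.semigroup t x := by
  refine ⟨fun t => (hL.exists_apply_semigroup t ⟨x, hx⟩).1,
    ⟨fun t => hL.semigroup t (L ⟨x, hx⟩), hL.continuous_semigroup_apply _,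
      hL.hasTimeDeriv_semigroup ⟨x, hx⟩,
      fun t _ => (hL.exists_apply_semigroup t ⟨x, hx⟩).2.symm⟩, ?_⟩
  simp [semigroup_zero]

end Generator

/-! ### Energy estimate and density in Hilbert space -/

section Hilbert

variable {𝕜 E : Type*} [RCLike 𝕜] [NormedAddCommGroup E] [InnerProductSpace 𝕜 E]
  {L : E →ₗ.[𝕜] E}

/-- The squared norm of the difference has derivative `2 Re⟪w, Lw⟫ ≤ 0`. The equation is available
only for `t > 0`; continuity covers the endpoint. -/
theorem _root_.AbstractWave.IsClassicalSolution.norm_sub_le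
    (hL : ∀ x : L.domain, RCLike.re (inner 𝕜 (x : E) (L x)) ≤ 0) {u₀ v₀ : E} {u v : ℝ≥0 → E}
    (hu : IsClassicalSolution L u₀ u) (hv : IsClassicalSolution L v₀ v) (t : ℝ≥0) :
    ‖u t - v t‖ ≤ ‖u₀ - v₀‖ := by
  let _ : InnerProductSpace ℝ E := InnerProductSpace.rclikeToReal 𝕜 E
  obtain ⟨hu, ⟨u', -, hu', hu''⟩, rfl⟩ := hu
  obtain ⟨hv, ⟨v', -, hv', hv''⟩, rfl⟩ := hv
  set f : ℝ → E := fun s => u s.toNNReal - v s.toNNReal with hf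
  have hd (s : ℝ) (hs : 0 ≤ s) : HasDerivWithinAt (fun s => ‖f s‖ ^ 2)
      (2 * inner ℝ (f s) (u' s.toNNReal - v' s.toNNReal)) (Set.Ici 0) s := by
    have h1 : HasDerivWithinAt (fun s : ℝ => u s.toNNReal) (u' s.toNNReal) (Set.Ici 0) s := by
      have := hu' s.toNNReal
      rwa [HasTimeDeriv, Real.coe_toNNReal s hs] at this
    have h2 : HasDerivWithinAt (fun s : ℝ => v s.toNNReal) (v' s.toNNReal) (Set.Ici 0) s := by
      have := hv' s.toNNReal
      rwa [HasTimeDeriv, Real.coe_toNNReal s hs] at this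
    exact (h1.sub h2).norm_sq
  have hanti : AntitoneOn (fun s => ‖f s‖ ^ 2) (Set.Ici 0) := by
    refine antitoneOn_of_hasDerivWithinAt_nonpos (convex_Ici 0)
      (fun s hs => (hd s hs).continuousWithinAt)
      (fun s hs => (hd s (interior_subset hs)).mono interior_subset) fun s hs => ?_
    rw [interior_Ici] at hs
    have hs' : 0 < s.toNNReal := Real.toNNReal_pos.2 hs
    have h := hL (⟨u s.toNNReal, hu _⟩ - ⟨v s.toNNReal, hv _⟩)
    rw [L.map_sub, ← hu'' _ hs', ← hv'' _ hs'] at h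
    have h' : inner ℝ (f s) (u' s.toNNReal - v' s.toNNReal) ≤ 0 := h
    linarith
  have h := hanti (Set.mem_Ici.2 le_rfl) (Set.mem_Ici.2 t.coe_nonneg) t.coe_nonneg
  simp only [hf, Real.toNNReal_coe, Real.toNNReal_zero] at h
  exact (sq_le_sq₀ (norm_nonneg _) (norm_nonneg _)).1 h

theorem wellPosed [CompleteSpace E] (hL : IsMDissipative L)
    (hL' : ∀ x : L.domain, RCLike.re (inner 𝕜 (x : E) (L x)) ≤ 0) : WellPosed L where
  existsUnique u₀ hu₀ := by
    refine ⟨_, hL.isClassicalSolution_semigroup hu₀, fun v hv => funext fun t => ?_⟩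
    have h := hv.norm_sub_le hL' (hL.isClassicalSolution_semigroup hu₀) t
    rwa [sub_self, norm_zero, norm_le_zero_iff, sub_eq_zero] at h
  continuous_dependence _ _ ε hε := ⟨ε, hε, fun _ _ _ _ hu hv h t _ =>
    (hu.norm_sub_le hL' hv t).trans_lt h⟩

/-- In a Hilbert space a dissipative operator with the range condition is densely defined. -/
theorem of_re_inner_nonpos [CompleteSpace E]
    (hL' : ∀ x : L.domain, RCLike.re (inner 𝕜 (x : E) (L x)) ≤ 0)
    (hr : ∀ c : ℝ, 0 < c → ∀ y : E, ∃ x : L.domain, (c : 𝕜) • (x : E) - L x = y) :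
    IsMDissipative L := by
  have key (c : ℝ) (x : L.domain) :
      c * ‖(x : E)‖ ^ 2 ≤ RCLike.re (inner 𝕜 (x : E) ((c : 𝕜) • (x : E) - L x)) := by
    rw [inner_sub_right, inner_smul_right, map_sub, RCLike.re_ofReal_mul,
      inner_self_eq_norm_sq]
    linarith [hL' x]
  refine ⟨?_, fun c hc x => ?_, hr⟩
  -- For `y` orthogonal to the domain, solve `x - Lx = y`; pairing with `x` gives `‖x‖² ≤ Re⟪x, y⟫ =
  -- 0`.
  · rw [Submodule.dense_iff_topologicalClosure_eq_top, Submodule.topologicalClosure_eq_top_iff,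
      Submodule.eq_bot_iff]
    intro y hy
    obtain ⟨x, hx⟩ := hr 1 one_pos y
    have h := key 1 x
    rw [hx, L.domain.mem_orthogonal y |>.1 hy x x.2, map_zero, one_mul] at h
    have h0 : x = 0 := Subtype.ext (norm_eq_zero.1 (pow_eq_zero_iff two_ne_zero |>.1
      (le_antisymm h (sq_nonneg _))))
    rw [← hx, h0, L.map_zero, Submodule.coe_zero, smul_zero, sub_zero]
  · have h1 := (key c x).trans (re_inner_le_norm _ _)
    rcases (norm_nonneg (x : E)).eq_or_lt with h0 | h0
    · rw [← h0, mul_zero]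
      exact norm_nonneg _
    · refine le_of_mul_le_mul_left ?_ h0
      linarith

end Hilbert

end IsMDissipative

/-! ### The wave operator -/

section WaveOperator

variable {𝕜 H : Type*} [RCLike 𝕜] [NormedAddCommGroup H] [InnerProductSpace 𝕜 H]
  (B : H →ₗ.[𝕜] H) (hB : BoundedBelow B)

instance : InnerProductSpace 𝕜 (Y B hB) where
  inner u v := inner 𝕜 (Y.map B hB u) (Y.map B hB v)
  norm_sq_eq_re_inner u := norm_sq_eq_re_inner (𝕜 := 𝕜) (Y.map B hB u)
  conj_inner_symm u v := inner_conj_symm (Y.map B hB u) (Y.map B hB v)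
  add_left u v w := by simp only [map_add, inner_add_left]
  smul_left u v c := by simp only [map_smul, inner_smul_left]

/-- The bounded inclusion of `Y = Dom(B)` into `H`. -/
def Y.incl : Y B hB →L[𝕜] H :=
  (B.domain.subtype ∘ₗ (Y.equiv B hB).toLinearMap).mkContinuousOfExistsBound (by
    obtain ⟨γ, hγ, h⟩ := hB
    refine ⟨(√γ)⁻¹, fun u => ?_⟩
    have hs : 0 < √γ := Real.sqrt_pos.2 hγ
    rw [inv_mul_eq_div, le_div_iff₀' hs]
    refine le_of_sq_le_sq ?_ (norm_nonneg _)
    rw [mul_pow, Real.sq_sqrt hγ.le]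
    exact h _)

theorem Y.isometry_map : Isometry (Y.map B hB) :=
  AddMonoidHomClass.isometry_of_norm _ fun _ => rfl

variable {B} in
-- A Cauchy sequence in `Y` has Cauchy images under `B` and, by the lower bound, is Cauchy in `H`;
-- the closed graph contains the limit pair.
theorem Y.completeSpace [CompleteSpace H] (hclosed : B.IsClosed) : CompleteSpace (Y B hB) := by
  refine Metric.complete_of_cauchySeq_tendsto fun u hu => ?_
  obtain ⟨x, hx⟩ := cauchySeq_tendsto_of_complete
    ((Y.incl B hB).uniformContinuous.comp_cauchySeq hu)
  obtain ⟨y, hy⟩ := cauchySeq_tendsto_of_complete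
    ((Y.isometry_map B hB).uniformContinuous.comp_cauchySeq hu)
  have h : (x, y) ∈ (B.graph : Set (H × H)) :=
    hclosed.mem_of_tendsto (hx.prodMk_nhds hy) (Eventually.of_forall fun n =>
      B.mem_graph (Y.equiv B hB (u n)))
  obtain ⟨z, -, rfl⟩ := B.mem_graph_iff.1 h
  exact ⟨(Y.equiv B hB).symm z,
    (Y.isometry_map B hB).isUniformInducing.isInducing.tendsto_nhds_iff.2 hy⟩

variable [CompleteSpace H]

variable {B}

theorem re_inner_opL (hdense : Dense (B.domain : Set H)) (x : (opL B hB).domain) :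
    RCLike.re (inner 𝕜 (x : X B hB) (opL B hB x)) = 0 := by
  obtain ⟨x, ⟨hx, hx'⟩, hv⟩ := x
  have h := B.adjoint_isFormalAdjoint hdense ⟨_, hx'⟩ ⟨x.snd, hv⟩
  rw [WithLp.prod_inner_apply]
  change RCLike.re (inner 𝕜 (B (Y.equiv B hB x.fst)) (B ⟨x.snd, hv⟩)
    + inner 𝕜 x.snd (-(B.adjoint ⟨_, hx'⟩))) = 0
  rw [inner_neg_right, ← inner_conj_symm x.snd, h, map_add, map_neg, RCLike.conj_re]
  exact add_neg_cancel _

/-- For the inclusion `J : Y → H`, the identity `⟪B J*g, Bw⟫ = ⟪g, w⟫` is the weak form of `Au = g`,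
so `J*` inverts `A`. The inverse of `L` is then `(u, v) ↦ (-J*v, Ju)`. -/
theorem exists_opL_eq [CompleteSpace (Y B hB)] (hdense : Dense (B.domain : Set H)) :
    ∃ K : X B hB →L[𝕜] X B hB, ∀ z, ∃ h : K z ∈ (opL B hB).domain, opL B hB ⟨K z, h⟩ = z := by
  let J := Y.incl B hB
  let e := WithLp.prodContinuousLinearEquiv 2 𝕜 (Y B hB) H
  have hJ (g : H) : ∃ h : (Y.equiv B hB (J.adjoint g) : H) ∈ (opA B).domain,
      opA B ⟨_, h⟩ = g := by
    have h1 (w : B.domain) : inner 𝕜 g (w : H) = inner 𝕜 (B (Y.equiv B hB (J.adjoint g))) (B w) :=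
      (J.adjoint_inner_left ((Y.equiv B hB).symm w) g).symm
    have h2 := B.mem_adjoint_domain_of_exists _ ⟨g, h1⟩
    exact ⟨⟨(Y.equiv B hB (J.adjoint g)).2, h2⟩, B.adjoint_apply_eq hdense ⟨_, h2⟩ h1⟩
  refine ⟨e.symm.toContinuousLinearMap ∘L
    ((J.adjoint ∘L (-ContinuousLinearMap.snd 𝕜 (Y B hB) H)).prod
      (J ∘L ContinuousLinearMap.fst 𝕜 (Y B hB) H)) ∘L e.toContinuousLinearMap, fun z => ?_⟩
  obtain ⟨h1, h2⟩ := hJ (-z.snd)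
  refine ⟨⟨h1, (Y.equiv B hB z.fst).2⟩, ?_⟩
  change WithLp.toLp 2 (z.fst, -(opA B ⟨_, h1⟩)) = z
  rw [h2, neg_neg]
  rfl

theorem isMDissipative_opL [CompleteSpace (Y B hB)] (hdense : Dense (B.domain : Set H)) :
    IsMDissipative (opL B hB) := by
  refine .of_re_inner_nonpos (fun x => (re_inner_opL hB hdense x).le) fun c hc y => ?_
  obtain ⟨K, hK⟩ := exists_opL_eq hB hdense
  -- Since `z = L(Kz)`, `Re⟪Kz, z⟫ = 0`, so `1 - cK` is coercive with constant 1.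
  have hu : IsUnit (1 - (c : 𝕜) • K) := by
    refine ContinuousLinearMap.isUnit_of_forall_le_norm_inner_map _ (c := 1) one_pos fun z => ?_
    obtain ⟨h1, h2⟩ := hK z
    have h3 := re_inner_opL hB hdense ⟨K z, h1⟩
    rw [h2] at h3
    have h4 : RCLike.re (inner 𝕜 ((1 - (c : 𝕜) • K) z) z) = ‖z‖ ^ 2 := by
      change RCLike.re (inner 𝕜 (z - (c : 𝕜) • K z) z) = _
      rw [inner_sub_left, inner_smul_left, RCLike.conj_ofReal, map_sub, RCLike.re_ofReal_mul, h3,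
        inner_self_eq_norm_sq, mul_zero, sub_zero]
    rw [NNReal.coe_one, mul_one, ← h4]
    exact RCLike.re_le_norm _
  -- The sign comes from `(c - L)Kz = -(1 - cK)z`.
  obtain ⟨z, hz⟩ := (ContinuousLinearMap.isUnit_iff_bijective.1 hu).2 (-y)
  obtain ⟨h1, h2⟩ := hK z
  refine ⟨⟨K z, h1⟩, ?_⟩
  rw [h2, ← neg_inj, ← hz]
  simp

end WaveOperator

end

end AbstractWave

theorem mainTheorem5 {𝕜 H : Type*} [RCLike 𝕜] [NormedAddCommGroup H] [InnerProductSpace 𝕜 H]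
    [CompleteSpace H] (B : H →ₗ.[𝕜] H) (hdense : Dense (B.domain : Set H))
    (hclosed : B.IsClosed) (hB : AbstractWave.BoundedBelow B) :
    CompleteSpace (AbstractWave.X B hB) ∧
    (∃ S : ℝ≥0 → AbstractWave.X B hB →L[𝕜] AbstractWave.X B hB,
      AbstractWave.IsC0Semigroup S ∧
      AbstractWave.IsGenerator S (AbstractWave.opL B hB) ∧
      ∀ t : ℝ≥0, 0 < t → ‖S t‖ ≤ 1) ∧
    AbstractWave.WellPosed (AbstractWave.opL B hB) := by
  have _ : CompleteSpace (AbstractWave.Y B hB) := AbstractWave.Y.completeSpace hB hclosed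
  have hL := AbstractWave.isMDissipative_opL hB hdense
  exact ⟨inferInstance, ⟨hL.semigroup, hL.isC0Semigroup_semigroup, hL.isGenerator_semigroup,
    fun t _ => hL.norm_semigroup_le t⟩,
    hL.wellPosed fun x => (AbstractWave.re_inner_opL hB hdense x).le⟩
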